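/- Let $M$ be a matroid of rank $r$ on a finite set $E$ with $|E|=n$, and fix a linear order $<$ on $E$. Write $\mathcal I(M)$ for the set of independent sets of $M$. For $S\subseteq E$ let $\operatorname{EA}(S)$ be the set of $e\in E\setminus S$ that are the maximum of some circuit contained in $S\cup\{e\}$, let $\operatorname{EP}(S)=(E\setminus S)\setminus\operatorname{EA}(S)$, and let $\operatorname{IA}(S)$ be the set of $i\in S$ that lie in $\operatorname{EA}(E\setminus S)$ computed in the dual matroid. Every $I\in\mathcal I(M)$ is uniquely of the form $I=B\setminus Y_I$ with $B$ a basis and $Y_I\subseteq\operatorname{IA}(B)$ (Crapo); $B$ is called the basis related to $I$, and two independent sets are internally related if they have the same related basis. For $I,J\in\mathcal I(M)$ put $I\le_{ext/int}J$ if either $I,J$ are not internally related and $(I\setminus\operatorname{IA}(I))\cup\operatorname{EA}(I)\subseteq (J\setminus\operatorname{IA}(J))\cup\operatorname{EA}(J)$, or $I,J$ are internally related and $I\subseteq J$. For $S\subseteq E$ write $x_S=\{x_e:e\in S\}$, and similarly $y_S$, $z_S$. The augmented external activity complex $\Delta_M$ is the simplicial complex on $\{x_e,y_e,z_e:e\in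 E\}$ generated by the sets $$F(I)=x_{I\cup \operatorname{EP}(I)}\cup y_{Y_I}\cup z_{I\cup\operatorname{EA}(I)},\qquad I\in\mathcal I(M).$$ For a simplicial complex $\Delta$ whose largest faces have $d$ elements, let $f_i$ be the number of faces with $i$ elements. The $h$-polynomial $h_\Delta(q)$ and the $h$-vector $(h_0,\dots,h_d)$ are defined by $h_\Delta(q)=\sum_{i=0}^d h_iq^{d-i}=\sum_{i=0}^d f_i(q-1)^{d-i}$. An ordering of the facets of a pure complex is a shelling order if for each facet $F$ preceding a facet $F'$ there are a facet $F''$ preceding $F'$ and $e\in F'$ with $F\cap F'\subseteq F''\cap F'=F'\setminus\{e\}$. The restriction set of a facet $F'$ in a shelling order is the subset $R\subseteq F'$ such that for all $A\subseteq F'$, $R\subseteq A$ if and only if $A$ is contained in no facet preceding $F'$. Then: 1. The relation $\le_{ext/int}$ is a partial order on $\mathcal I(M)$. For every linear extension $\prec$ of it, $\Delta_M$ is pure, $I\mapsto F(I)$ is a bijection from $\mathcal I(M)$ onto the facets of $\Delta_M$, and the facets ordered by $\prec$ are in a shelling order. For every $I\in\mathcal I(M)$ the restriction set of $F(I)$ in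 this order is $z_I$. 2. The $h$-vector of $\Delta_M$ equals the $f$-vector of the independence complex of $M$: $h_i(\Delta_M)$ is the number of independent sets of $M$ with $i$ elements, for every $i$ (both being $0$ outside their index range). 3. The $h$-polynomial of $\Delta_M$ is $$h_{\Delta_M}(q)=\sum_{I\in\mathcal I(M)}q^{\,n+r-|I|}=q^n\,T_M(1+q,1),$$ where $T_M(x,y)=\sum_{S\subseteq E}(x-1)^{r-\operatorname{rk}(S)}(y-1)^{|S|-\operatorname{rk}(S)}$ is the Tutte polynomial of $M$. -/

import Mathlib

noncomputable section

open scoped Classical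

/-! ### Finite simplicial complexes, shellings, `f`- and `h`-vectors -/

/-- A finite abstract simplicial complex. The empty set is a face, as is the convention for face
numbers of complexes; a point of the ground type need not be a vertex. -/
@[ext]
structure FaceComplex (V : Type*) where
  faces : Finset (Finset V)
  empty_mem : ∅ ∈ faces
  down_closed : ∀ ⦃G H : Finset V⦄, H ∈ faces → G ⊆ H → G ∈ faces

namespace FaceComplex

variable {V : Type*}

/-- The complex generated by a nonempty finite family of finite sets. -/
def generatedBy (s : Finset (Finset V)) (hs : s.Nonempty) : FaceComplex V where
  faces := s.biUnion Finset.powerset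
  empty_mem := by
    obtain ⟨F, hF⟩ := hs
    exact Finset.mem_biUnion.2 ⟨F, hF, Finset.empty_mem_powerset F⟩
  down_closed := by
    intro G H hH hGH
    obtain ⟨F, hF, hHF⟩ := Finset.mem_biUnion.1 hH
    exact Finset.mem_biUnion.2
      ⟨F, hF, Finset.mem_powerset.2 (hGH.trans (Finset.mem_powerset.1 hHF))⟩

/-- A facet is an inclusion-maximal face. -/
def IsFacet (Δ : FaceComplex V) (F : Finset V) : Prop :=
  F ∈ Δ.faces ∧ ∀ G ∈ Δ.faces, F ⊆ G → F = G

/-- All facets have the same cardinality. -/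
def IsPure (Δ : FaceComplex V) : Prop :=
  ∀ F G, Δ.IsFacet F → Δ.IsFacet G → F.card = G.card

/-- The maximal cardinality of a face, that is, one more than the dimension. -/
def maxCard (Δ : FaceComplex V) : ℕ := Δ.faces.sup Finset.card

/-- `f_i` is the number of faces of cardinality `i` (dimension `i - 1`). -/
def fVector (Δ : FaceComplex V) (i : ℕ) : ℕ := (Δ.faces.filter fun G => G.card = i).card

/-- The `h`-polynomial `∑ h_i q^(d-i) = ∑ f_i (q-1)^(d-i)`, with `d - 1` the dimension. -/
def hPolynomial (Δ : FaceComplex V) : Polynomial ℤ :=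
  ∑ i ∈ Finset.range (Δ.maxCard + 1),
    Polynomial.C (Δ.fVector i : ℤ) * (Polynomial.X - 1) ^ (Δ.maxCard - i)

/-- `h_i` is the coefficient of `q^(d-i)` in the `h`-polynomial (and `0` for `i > d`). -/
def hVector (Δ : FaceComplex V) (i : ℕ) : ℤ :=
  if i ≤ Δ.maxCard then Δ.hPolynomial.coeff (Δ.maxCard - i) else 0

/-- `F` lists the facets of the pure complex `Δ`, each exactly once, and ordering them by the
linear order `L` of the index type is a shelling order. -/
def IsShellingOrder (Δ : FaceComplex V) {ι : Type*} (L : LinearOrder ι) (F : ι → Finset V) :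
    Prop :=
  Δ.IsPure ∧ Function.Injective F ∧ (∀ G, Δ.IsFacet G ↔ ∃ i, F i = G) ∧
    ∀ i k, L.lt i k → ∃ j, L.lt j k ∧ ∃ e ∈ F k,
      F i ∩ F k ⊆ F j ∩ F k ∧ F j ∩ F k = F k \ {e}

end FaceComplex

/-- `R` is the restriction set of `F k` when the sets `F i` are ordered by `L`: a subset
`A` of `F k` contains `R` exactly when it lies in no earlier `F i`. -/
def IsRestrictionSet {V ι : Type*} (L : LinearOrder ι) (F : ι → Finset V) (k : ι)
    (R : Finset V) : Prop :=
  R ⊆ F k ∧ ∀ A, A ⊆ F k → (R ⊆ A ↔ ∀ i, L.lt i k → ¬ A ⊆ F i)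

/-! ### Activities in a finite matroid with a linear order on its elements -/

namespace Matroid

variable {α : Type*}

/-- The ground set of a finite matroid, as a finset. -/
def groundFinset (M : Matroid α) [M.Finite] : Finset α := M.ground_finite.toFinset

/-- The rank of a finite matroid, as a natural number. -/
def natRank (M : Matroid α) : ℕ := M.eRank.toNat

/-- The rank of a set in a finite matroid, as a natural number. -/
def natRk (M : Matroid α) (S : Set α) : ℕ := (M.eRk S).toNat

/-- The Tutte polynomial `T_M(x, y) = ∑_{S ⊆ E} (x-1)^(r(E)-r(S)) (y-1)^(|S|-r(S))`, with
`x` and `y` the variables of index `0` and `1`. -/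
def tuttePolynomial (M : Matroid α) [M.Finite] : MvPolynomial (Fin 2) ℤ :=
  ∑ S ∈ M.groundFinset.powerset,
    (MvPolynomial.X 0 - 1) ^ (M.natRank - M.natRk (S : Set α)) *
      (MvPolynomial.X 1 - 1) ^ (S.card - M.natRk (S : Set α))

/-- The independent sets of a finite matroid. -/
def indepFinsets (M : Matroid α) [M.Finite] : Finset (Finset α) :=
  M.groundFinset.powerset.filter fun I => M.Indep (I : Set α)

theorem mem_indepFinsets {M : Matroid α} [M.Finite] {I : Finset α} :
    I ∈ M.indepFinsets ↔ M.Indep (I : Set α) := by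
  refine ⟨fun h => (Finset.mem_filter.1 h).2, fun h => Finset.mem_filter.2 ⟨?_, h⟩⟩
  refine Finset.mem_powerset.2 fun e he => ?_
  exact M.ground_finite.mem_toFinset.2 (h.subset_ground (Finset.mem_coe.2 he))

theorem empty_mem_indepFinsets (M : Matroid α) [M.Finite] : ∅ ∈ M.indepFinsets :=
  mem_indepFinsets.2 (by simp)

/-- The type of independent sets of `M`. -/
abbrev IndepSet (M : Matroid α) [M.Finite] : Type _ := {I : Finset α // I ∈ M.indepFinsets}

/-- The independence complex of `M`. -/
def independenceComplex (M : Matroid α) [M.Finite] : FaceComplex α where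
  faces := M.indepFinsets
  empty_mem := M.empty_mem_indepFinsets
  down_closed := fun _ _ hH hGH =>
    mem_indepFinsets.2 ((mem_indepFinsets.1 hH).subset (Finset.coe_subset.2 hGH))

variable [LinearOrder α]

/-- Externally active elements: `e ∈ E \ S` such that some circuit contained in `S ∪ e` has
maximum element `e`. -/
def EA (M : Matroid α) [M.Finite] (S : Finset α) : Finset α :=
  (M.groundFinset \ S).filter fun e =>
    ∃ γ : Set α, M.IsCircuit γ ∧ γ ⊆ insert e (S : Set α) ∧ IsGreatest γ e

/-- Externally passive elements. -/
def EP (M : Matroid α) [M.Finite] (S : Finset α) : Finset α := (M.groundFinset \ S) \ M.EA S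

/-- Internally active elements: `i ∈ S` that are externally active with respect to `E \ S` in the
dual matroid. -/
def IA (M : Matroid α) [M.Finite] (S : Finset α) : Finset α :=
  S.filter fun i => i ∈ M✶.EA (M.groundFinset \ S)

/-- `I = B \ Y` with `B` a basis of `M` and `Y` a set of internally active elements of `B`. -/
def IsRelatedBasis (M : Matroid α) [M.Finite] (I B : Finset α) : Prop :=
  M.IsBase (B : Set α) ∧ ∃ Y, Y ⊆ M.IA B ∧ I = B \ Y

/-- `I` and `J` are internally related. -/
def InternallyRelated (M : Matroid α) [M.Finite] (I J : Finset α) : Prop :=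
  ∃ B, M.IsRelatedBasis I B ∧ M.IsRelatedBasis J B

/-- The external/internal order on independent sets. -/
def ExtIntLE (M : Matroid α) [M.Finite] (I J : M.IndepSet) : Prop :=
  (¬ M.InternallyRelated I J ∧
      ((I : Finset α) \ M.IA I) ∪ M.EA I ⊆ ((J : Finset α) \ M.IA J) ∪ M.EA J) ∨
    (M.InternallyRelated I J ∧ (I : Finset α) ⊆ J)

/-- A linear order on the independent sets that extends the external/internal order. -/
def IsLinearExtension (M : Matroid α) [M.Finite] (L : LinearOrder M.IndepSet) : Prop :=
  ∀ I J : M.IndepSet, M.ExtIntLE I J → L.le I J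

/-- The basis related to an independent set `I` (by Crapo's theorem there is exactly one). -/
def relatedBasis (M : Matroid α) [M.Finite] (I : Finset α) : Finset α :=
  if h : ∃ B, M.IsRelatedBasis I B then h.choose else ∅

end Matroid

/-! ### The augmented external activity complex -/

/-- The ground set `E(x, y, z) = {x_e, y_e, z_e : e ∈ E}`. -/
inductive XYZ (α : Type*) where
  | x (e : α) : XYZ α
  | y (e : α) : XYZ α
  | z (e : α) : XYZ α

/-- `x_S = {x_e : e ∈ S}`. -/
def xSet {α : Type*} (S : Finset α) : Finset (XYZ α) := S.image XYZ.x

/-- `y_S = {y_e : e ∈ S}`. -/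
def ySet {α : Type*} (S : Finset α) : Finset (XYZ α) := S.image XYZ.y

/-- `z_S = {z_e : e ∈ S}`. -/
def zSet {α : Type*} (S : Finset α) : Finset (XYZ α) := S.image XYZ.z

namespace Matroid

variable {α : Type*} [LinearOrder α]

/-- `F(I) = x_{I ∪ EP(I)} y_Y z_{I ∪ EA(I)}`, where `I = B \ Y` with `B` the related basis. -/
def augFacet (M : Matroid α) [M.Finite] (I : Finset α) : Finset (XYZ α) :=
  xSet (I ∪ M.EP I) ∪ ySet (M.relatedBasis I \ I) ∪ zSet (I ∪ M.EA I)

/-- The augmented external activity complex `Δ_M`. -/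
def augComplex (M : Matroid α) [M.Finite] : FaceComplex (XYZ α) :=
  FaceComplex.generatedBy (M.indepFinsets.image M.augFacet)
    (Finset.Nonempty.image ⟨∅, M.empty_mem_indepFinsets⟩ _)

end Matroid

end

/-!
The argument is expressed through two closure operations on subsets `S` of `E`: the set `L(S)` of
elements spanned by the smaller elements of `S` (`Matroid.lowerClosure`), and the set `N(S)` given
by the same construction for `E \ S` in the dual matroid (`Matroid.dualLowerClosure`). Then
`EA(S) = L(S) \ S` and `IA(S) = N(S) ∩ S`, and the greedy algorithm in the dual matroid shows that
the basis related to an independent set `I` is `I ∪ N(I)` (`Matroid.isRelatedBasis_iff`). Hence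
`F(I)` is `x_{E \ L(I)} ∪ y_{N(I) \ I} ∪ z_{I ∪ L(I)}`, of size `n + r`.

Both `L` and `N` are constant on the interval from `B \ IA(B)` to `B ∪ EA(B)`, and they recover the
basis `B` from any set of this interval (`Matroid.IsBase.eq_of_mem_interval`). The set
`(I \ IA(I)) ∪ EA(I)` lies in the interval of the basis related to `I`, so distinct related bases
give distinct sets, and the external/internal order is a partial order.

The shelling rests on two facts.

* If `F(J)` contains `z_I`, that is, if `I ⊆ J ∪ EA(J)`, then `I` is at most `J` in the
  external/internal order (`Matroid.extIntLE_of_subset`).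
* For `i ∈ I` some earlier facet contains `F(I) \ {z_i}`
  (`Matroid.exists_augFacet_sdiff_subset`). If `L(I \ {i}) = L(I)`, the facet of `I \ {i}` does.
  Otherwise, with `j` the least element of `L(I)` outside `L(I \ {i})`, the facet of
  `(I \ {i}) ∪ {j}` does, by exchange (`Matroid.Indep.exists_exchange`).

For any complex, two such facts make the order a shelling in which `z_I` is the restriction set of
`F(I)` (`FaceComplex.IsShellingData`). The faces are then partitioned into the intervals from `z_I`
to `F(I)`, each of which contributes `q ^ (n + r - |I|)` to the `h`-polynomial; this gives the
`h`-vector, and at `y = 1` the Tutte polynomial is a sum over independent sets as well.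
-/

noncomputable section

open scoped Classical

/-! ### Shellings and the `h`-polynomial -/

namespace FaceComplex

/-- The data of a shelling, in the form in which it is verified here: `F` lists sets of equal size
`d` whose subsets are the faces of `Δ`, and `R i ⊆ F i` are sets such that every `F j` containing
`R i` comes weakly after `F i`, while deleting an element of `R i` from `F i` gives a subset of an
earlier `F j`. -/
structure IsShellingData {V ι : Type*} (Δ : FaceComplex V) (L : LinearOrder ι)
    (F R : ι → Finset V) (d : ℕ) : Prop where
  mem_faces : ∀ G, G ∈ Δ.faces ↔ ∃ i, G ⊆ F i
  card_eq : ∀ i, (F i).card = d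
  subset : ∀ i, R i ⊆ F i
  le_of_subset : ∀ i j, R i ⊆ F j → L.le i j
  exists_lt : ∀ i, ∀ v ∈ R i, ∃ j, L.lt j i ∧ F i \ {v} ⊆ F j

namespace IsShellingData

variable {V ι : Type*} {Δ : FaceComplex V} {L : LinearOrder ι} {F R : ι → Finset V} {d : ℕ}

theorem injective (h : Δ.IsShellingData L F R d) : Function.Injective F := fun i j hij =>
  le_antisymm (h.le_of_subset i j (hij ▸ h.subset i)) (h.le_of_subset j i (hij ▸ h.subset j))

theorem isFacet_iff (h : Δ.IsShellingData L F R d) (G : Finset V) :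
    Δ.IsFacet G ↔ ∃ i, F i = G := by
  constructor
  · rintro ⟨hG, hmax⟩
    obtain ⟨i, hi⟩ := (h.mem_faces G).1 hG
    exact ⟨i, (hmax _ ((h.mem_faces _).2 ⟨i, subset_rfl⟩) hi).symm⟩
  · rintro ⟨i, rfl⟩
    refine ⟨(h.mem_faces _).2 ⟨i, subset_rfl⟩, fun G hG hiG => ?_⟩
    obtain ⟨j, hj⟩ := (h.mem_faces G).1 hG
    refine Finset.eq_of_subset_of_card_le hiG ?_
    rw [h.card_eq i, ← h.card_eq j]
    exact Finset.card_le_card hj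

/-- The earlier facet containing `F i \ {v}` does not contain `v`, as otherwise it would contain
the restriction set `R i`. -/
theorem exists_lt_inter (h : Δ.IsShellingData L F R d) {i : ι} {v : V} (hv : v ∈ R i) :
    ∃ j, L.lt j i ∧ F j ∩ F i = F i \ {v} := by
  obtain ⟨j, hji, hj⟩ := h.exists_lt i v hv
  refine ⟨j, hji, ?_⟩
  have hvj : v ∉ F j := fun hvj => by
    refine not_le_of_gt hji (h.le_of_subset i j fun w hw => ?_)
    by_cases hwv : w = v
    · exact hwv ▸ hvj
    · exact hj (by simp [hwv, h.subset i hw])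
  ext w
  have := @hj w
  simp only [Finset.mem_sdiff, Finset.mem_singleton, Finset.mem_inter] at this ⊢
  constructor
  · rintro ⟨hwj, hwi⟩
    exact ⟨hwi, fun hwv => hvj (hwv ▸ hwj)⟩
  · rintro ⟨hwi, hwv⟩
    exact ⟨this ⟨hwi, hwv⟩, hwi⟩

theorem isShellingOrder (h : Δ.IsShellingData L F R d) : Δ.IsShellingOrder L F := by
  refine ⟨?_, h.injective, h.isFacet_iff, fun i k hik => ?_⟩
  · intro G G' hG hG'
    obtain ⟨i, rfl⟩ := (h.isFacet_iff G).1 hG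
    obtain ⟨j, rfl⟩ := (h.isFacet_iff G').1 hG'
    rw [h.card_eq, h.card_eq]
  · obtain ⟨v, hvk, hvi⟩ := Finset.not_subset.1 fun hki => not_le_of_gt hik (h.le_of_subset k i hki)
    obtain ⟨j, hjk, hj⟩ := h.exists_lt_inter hvk
    refine ⟨j, hjk, v, h.subset k hvk, ?_, hj⟩
    rw [hj]
    intro w hw
    rw [Finset.mem_inter] at hw
    rw [Finset.mem_sdiff, Finset.mem_singleton]
    exact ⟨hw.2, fun hwv => hvi (hwv ▸ hw.1)⟩

theorem isRestrictionSet (h : Δ.IsShellingData L F R d) (i : ι) : IsRestrictionSet L F i (R i) := by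
  refine ⟨h.subset i, fun A hA => ⟨fun hRA j hji hAj => ?_, fun hA' v hv => ?_⟩⟩
  · exact not_le_of_gt hji (h.le_of_subset i j (hRA.trans hAj))
  · by_contra hvA
    obtain ⟨j, hji, hj⟩ := h.exists_lt i v hv
    refine hA' j hji (subset_trans (fun w hw => ?_) hj)
    rw [Finset.mem_sdiff, Finset.mem_singleton]
    exact ⟨hA hw, fun hwv => hvA (hwv ▸ hw)⟩

/-- The intervals `[R i, F i]` partition the faces: a face lies in the interval of the first facet
containing it, and in no other. -/
theorem existsUnique_mem_Icc [Finite ι] (h : Δ.IsShellingData L F R d) {G : Finset V}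
    (hG : G ∈ Δ.faces) : ∃! i, R i ⊆ G ∧ G ⊆ F i := by
  obtain ⟨i, hi, hmin⟩ := Set.exists_min_image {i | G ⊆ F i} id (Set.toFinite _)
    ((h.mem_faces G).1 hG)
  refine ⟨i, ⟨((h.isRestrictionSet i).2 G hi).2 fun j hji hj => not_le_of_gt hji (hmin j hj), hi⟩,
    fun j hj => ?_⟩
  exact le_antisymm (h.le_of_subset j i (hj.1.trans hi)) (hmin j hj.2)

theorem maxCard_eq (h : Δ.IsShellingData L F R d) : Δ.maxCard = d := by
  apply le_antisymm
  · refine Finset.sup_le fun G hG => ?_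
    obtain ⟨i, hi⟩ := (h.mem_faces G).1 hG
    exact (Finset.card_le_card hi).trans (h.card_eq i).le
  · obtain ⟨i, -⟩ := (h.mem_faces ∅).1 Δ.empty_mem
    rw [← h.card_eq i]
    exact Finset.le_sup (f := Finset.card) ((h.mem_faces _).2 ⟨i, subset_rfl⟩)

end IsShellingData

variable {V : Type*}

theorem hPolynomial_eq_sum_faces (Δ : FaceComplex V) :
    Δ.hPolynomial = ∑ G ∈ Δ.faces, (Polynomial.X - 1 : Polynomial ℤ) ^ (Δ.maxCard - G.card) := by
  have hmaps : ∀ G ∈ Δ.faces, G.card ∈ Finset.range (Δ.maxCard + 1) := fun G hG =>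
    Finset.mem_range.2 (Nat.lt_succ_of_le (Finset.le_sup (f := Finset.card) hG))
  rw [hPolynomial, ← Finset.sum_fiberwise_of_maps_to hmaps]
  refine Finset.sum_congr rfl fun i _ => ?_
  rw [Finset.sum_congr rfl (g := fun _ => (Polynomial.X - 1 : Polynomial ℤ) ^ (Δ.maxCard - i))
    fun G hG => by rw [(Finset.mem_filter.1 hG).2]]
  simp [fVector]

/-- The contribution of an interval `[R, F]` of faces to the `h`-polynomial, by the binomial
theorem for `(q - 1) + 1`. -/
theorem sum_Icc_pow {R F : Finset V} (hRF : R ⊆ F) :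
    ∑ G ∈ Finset.Icc R F, (Polynomial.X - 1 : Polynomial ℤ) ^ (F.card - G.card) =
      Polynomial.X ^ (F.card - R.card) := by
  have hbin := Finset.sum_pow_mul_eq_add_pow (Polynomial.X - 1 : Polynomial ℤ) 1 (F \ R)
  simp only [one_pow, mul_one, sub_add_cancel] at hbin
  rw [← Finset.card_sdiff_of_subset hRF, ← hbin]
  refine Finset.sum_nbij' (fun G => F \ G) (fun T => F \ T) ?_ ?_ ?_ ?_ ?_
  · intro G hG
    rw [Finset.mem_Icc] at hG
    exact Finset.mem_powerset.2 (Finset.sdiff_subset_sdiff subset_rfl hG.1)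
  · intro T hT
    rw [Finset.mem_powerset] at hT
    refine Finset.mem_Icc.2 ⟨fun v hv => ?_, Finset.sdiff_subset⟩
    exact Finset.mem_sdiff.2 ⟨hRF hv, fun hvT => (Finset.mem_sdiff.1 (hT hvT)).2 hv⟩
  · intro G hG
    exact Finset.sdiff_sdiff_eq_self (Finset.mem_Icc.1 hG).2
  · intro T hT
    exact Finset.sdiff_sdiff_eq_self ((Finset.mem_powerset.1 hT).trans Finset.sdiff_subset)
  · intro G hG
    rw [Finset.card_sdiff_of_subset (Finset.mem_Icc.1 hG).2]

theorem IsShellingData.hPolynomial_eq {ι : Type*} [Fintype ι] {Δ : FaceComplex V}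
    {L : LinearOrder ι} {F R : ι → Finset V} {d : ℕ} (h : Δ.IsShellingData L F R d) :
    Δ.hPolynomial = ∑ i, (Polynomial.X : Polynomial ℤ) ^ (d - (R i).card) := by
  have hfaces : Δ.faces = Finset.univ.biUnion fun i => Finset.Icc (R i) (F i) := by
    ext G
    simp only [Finset.mem_biUnion, Finset.mem_univ, true_and, Finset.mem_Icc]
    exact ⟨fun hG => (h.existsUnique_mem_Icc hG).exists,
      fun ⟨i, hi⟩ => (h.mem_faces G).2 ⟨i, hi.2⟩⟩
  rw [hPolynomial_eq_sum_faces, h.maxCard_eq, hfaces, Finset.sum_biUnion]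
  · refine Finset.sum_congr rfl fun i _ => ?_
    have := sum_Icc_pow (h.subset i)
    rwa [h.card_eq] at this
  · intro i _ j _ hij
    refine Finset.disjoint_left.2 fun G hGi hGj => hij ?_
    rw [Finset.mem_Icc] at hGi hGj
    exact (h.existsUnique_mem_Icc ((h.mem_faces G).2 ⟨i, hGi.2⟩)).unique hGi hGj

end FaceComplex

/-! ### Closures of initial segments of a set -/

namespace Matroid

variable {α : Type*}

theorem mem_dual_closure_iff {M : Matroid α} {e : α} {X : Set α} (he : e ∈ M.E) (heX : e ∉ X) :
    e ∈ M✶.closure X ↔ e ∉ M.closure (M.E \ insert e X) := by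
  have heY : e ∉ M.E \ insert e X := fun h => h.2 (Set.mem_insert e X)
  constructor
  · intro h h'
    obtain ⟨D, hDX, hD, heD⟩ := exists_isCircuit_of_mem_closure h heX
    obtain ⟨C, hCY, hC, heC⟩ := exists_isCircuit_of_mem_closure h' heY
    refine hC.inter_isCocircuit_ne_singleton hD (e := e) (subset_antisymm ?_ (by simp [heC, heD]))
    rintro f ⟨hfC, hfD⟩
    rcases hCY hfC with hf | hf
    · exact hf
    · exact absurd (hDX hfD) hf.2
  · intro h
    obtain ⟨J, hJ⟩ := M.exists_isBasis (M.E \ insert e X) Set.sdiff_subset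
    have heJ : e ∉ M.closure J := by rwa [hJ.closure_eq_closure]
    obtain ⟨B, hB, hJB⟩ := ((hJ.indep.insert_indep_iff).2 (Or.inl ⟨he, heJ⟩)).exists_isBase_superset
    have heB : e ∈ B := hJB (Set.mem_insert e J)
    have hD := hB.compl_closure_sdiff_singleton_isCocircuit heB
    rw [mem_closure_iff_exists_isCircuit heX]
    refine ⟨_, ?_, hD, he, hB.indep.notMem_closure_sdiff_of_mem heB⟩
    rintro f ⟨hfE, hf⟩
    by_contra hfX
    refine hf (M.closure_subset_closure (X := J) ?_ (hJ.subset_closure ⟨hfE, hfX⟩))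
    exact fun g hg => ⟨hJB (Set.mem_insert_of_mem e hg),
      fun hge => heY (hge ▸ hJ.subset hg)⟩

variable [LinearOrder α]

/-- The elements spanned by the strictly smaller elements of `S`. The externally active elements of
`S` are those not in `S`; the elements that a greedy algorithm discards are those in `S`. -/
def lowerClosure (M : Matroid α) (S : Set α) : Set α := {e | e ∈ M.closure (S ∩ Set.Iio e)}

/-- The elements that are in the lower closure of the complement of `S` in the dual matroid. Those
in `S` are the internally active elements of `S`; for `S` independent, those outside `S` complete
`S` to its related basis. -/
def dualLowerClosure (M : Matroid α) (S : Set α) : Set α := M✶.lowerClosure (M.E \ S)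

theorem lowerClosure_subset_ground (M : Matroid α) (S : Set α) : M.lowerClosure S ⊆ M.E :=
  fun _ he => mem_ground_of_mem_closure he

theorem lowerClosure_subset_closure (M : Matroid α) (S : Set α) :
    M.lowerClosure S ⊆ M.closure S :=
  fun _ he => M.closure_subset_closure Set.inter_subset_left he

theorem dualLowerClosure_subset_ground (M : Matroid α) (S : Set α) :
    M.dualLowerClosure S ⊆ M.E :=
  M✶.lowerClosure_subset_ground _

theorem lowerClosure_mono (M : Matroid α) {S T : Set α} (h : S ⊆ T) :
    M.lowerClosure S ⊆ M.lowerClosure T :=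
  fun _ he => M.closure_subset_closure (Set.inter_subset_inter_left _ h) he

theorem lowerClosure_subset_of_subset {M : Matroid α} {S T : Set α} (hTE : T ⊆ M.E)
    (h : T ⊆ S ∪ M.lowerClosure S) : M.lowerClosure T ⊆ M.lowerClosure S := by
  intro e he
  refine M.closure_subset_closure_of_subset_closure ?_ he
  rintro f ⟨hfT, hfe⟩
  rcases h hfT with hf | hf
  · exact M.mem_closure_of_mem' ⟨hf, hfe⟩ (hTE hfT)
  · exact M.closure_subset_closure
      (Set.inter_subset_inter_right _ (Set.Iio_subset_Iio (le_of_lt hfe))) hf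

theorem Indep.notMem_lowerClosure {M : Matroid α} {I : Set α} (hI : M.Indep I) {e : α}
    (he : e ∈ I) : e ∉ M.lowerClosure I := fun h =>
  hI.notMem_closure_sdiff_of_mem he
    (M.closure_subset_closure (show I ∩ Set.Iio e ⊆ I \ {e} from
      fun _ hf => ⟨hf.1, ne_of_lt hf.2⟩) h)

theorem mem_dualLowerClosure_iff {M : Matroid α} {S : Set α} {e : α} (he : e ∈ M.E) :
    e ∈ M.dualLowerClosure S ↔ e ∉ M.closure ((S ∪ Set.Ioi e) \ {e}) := by
  have h : M.E \ insert e ((M.E \ S) ∩ Set.Iio e) = ((S ∪ Set.Ioi e) \ {e}) ∩ M.E := by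
    ext f
    simp only [Set.mem_sdiff, Set.mem_insert_iff, Set.mem_inter_iff, Set.mem_Iio, Set.mem_union,
      Set.mem_Ioi, Set.mem_singleton_iff]
    have := lt_trichotomy f e
    constructor
    · rintro ⟨hf, hf'⟩
      push Not at hf'
      refine ⟨⟨?_, hf'.1⟩, hf⟩
      by_cases hfS : f ∈ S
      · exact Or.inl hfS
      · exact Or.inr (lt_of_le_of_ne (hf'.2 ⟨hf, hfS⟩) (Ne.symm hf'.1))
    · rintro ⟨⟨hf, hfe⟩, hfE⟩
      refine ⟨hfE, ?_⟩
      rintro (h | ⟨⟨-, h⟩, h'⟩)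
      · exact hfe h
      · exact hf.elim h (not_lt_of_gt h')
  change e ∈ M✶.closure ((M.E \ S) ∩ Set.Iio e) ↔ _
  rw [mem_dual_closure_iff he (fun h => lt_irrefl e h.2), h, closure_inter_ground]

/-! ### The greedy basis -/

/-- Discarding from `S` the elements spanned by smaller elements of `S` does not change what is
spanned by the smaller elements: this is the greedy algorithm. -/
theorem lowerClosure_sdiff_lowerClosure (M : Matroid α) [M.Finite] {S : Set α} (hS : S ⊆ M.E) :
    M.lowerClosure (S \ M.lowerClosure S) = M.lowerClosure S := by
  refine subset_antisymm (M.lowerClosure_mono Set.sdiff_subset) fun e he => ?_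
  refine M.ground_finite.wellFoundedOn (r := (· < ·)).induction
    (P := fun e => e ∈ M.lowerClosure S → e ∈ M.lowerClosure (S \ M.lowerClosure S))
    (M.lowerClosure_subset_ground S he) (fun e _ ih he => ?_) he
  refine M.closure_subset_closure_of_subset_closure ?_ he
  rintro f ⟨hfS, hfe⟩
  by_cases hf : f ∈ M.lowerClosure S
  · exact M.closure_subset_closure (Set.inter_subset_inter_right _
      (Set.Iio_subset_Iio (le_of_lt hfe))) (ih f (hS hfS) hfe hf)
  · exact M.mem_closure_of_mem' ⟨⟨hfS, hf⟩, hfe⟩ (hS hfS)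

theorem isBasis_sdiff_lowerClosure (M : Matroid α) [M.Finite] {S : Set α} (hS : S ⊆ M.E) :
    M.IsBasis (S \ M.lowerClosure S) S := by
  rw [isBasis_iff_indep_subset_closure]
  refine ⟨?_, Set.sdiff_subset, fun e he => ?_⟩
  · by_contra hdep
    obtain ⟨C, hCS, hC⟩ :=
      ((not_indep_iff (Set.sdiff_subset.trans hS)).1 hdep).exists_isCircuit_subset
    obtain ⟨e, heC, hmax⟩ :=
      Set.exists_max_image C id (M.ground_finite.subset hC.subset_ground) hC.nonempty
    refine (hCS heC).2 (M.closure_subset_closure ?_ (hC.mem_closure_sdiff_singleton_of_mem heC))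
    exact fun f hf => ⟨(hCS hf.1).1, lt_of_le_of_ne (hmax f hf.1) hf.2⟩
  · by_cases h : e ∈ M.lowerClosure S
    · rw [← M.lowerClosure_sdiff_lowerClosure hS] at h
      exact M.lowerClosure_subset_closure _ h
    · exact M.mem_closure_of_mem' ⟨he, h⟩ (hS he)

/-! ### Crapo intervals -/

/-- A circuit in `B ∪ {e}` with maximum `e` contains no internally active element `b` of the
basis `B`, as it would meet the cocircuit witnessing the activity of `b` in `b` alone. -/
theorem IsBase.lowerClosure_subset_lowerClosure_sdiff {M : Matroid α} {B : Set α}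
    (hB : M.IsBase B) : M.lowerClosure B ⊆ M.lowerClosure (B \ M.dualLowerClosure B) := by
  intro e he
  have heB : e ∉ B := fun h => hB.indep.notMem_lowerClosure h he
  obtain ⟨C, hCB, hC, heC⟩ := exists_isCircuit_of_mem_closure he fun h => heB h.1
  refine M.closure_subset_closure ?_ (hC.mem_closure_sdiff_singleton_of_mem heC)
  rintro b ⟨hbC, hbe⟩
  have hb : b ∈ B ∩ Set.Iio e := (hCB hbC).resolve_left hbe
  refine ⟨⟨hb.1, fun hb' => ?_⟩, hb.2⟩
  obtain ⟨D, hDB, hD, hbD⟩ := exists_isCircuit_of_mem_closure hb' fun h => h.1.2 hb.1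
  refine hC.inter_isCocircuit_ne_singleton hD (e := b) (subset_antisymm ?_ (by simp [hbC, hbD]))
  rintro f ⟨hfC, hfD⟩
  rcases hDB hfD with hf | hf
  · exact hf
  · rcases hCB hfC with rfl | hf'
    · exact absurd hf.2 (not_lt_of_gt hb.2)
    · exact absurd hf'.1 hf.1.2

/-- The lower closure is constant on the interval from `B \ IA(B)` to `B ∪ EA(B)`. -/
theorem IsBase.lowerClosure_eq {M : Matroid α} {B S : Set α} (hB : M.IsBase B) (hSE : S ⊆ M.E)
    (h₁ : B \ M.dualLowerClosure B ⊆ S) (h₂ : S ⊆ B ∪ M.lowerClosure B) :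
    M.lowerClosure S = M.lowerClosure B :=
  subset_antisymm (lowerClosure_subset_of_subset hSE h₂)
    (hB.lowerClosure_subset_lowerClosure_sdiff.trans (M.lowerClosure_mono h₁))

theorem IsBase.dualLowerClosure_eq {M : Matroid α} {B S : Set α} (hB : M.IsBase B)
    (h₁ : B \ M.dualLowerClosure B ⊆ S) (h₂ : S ⊆ B ∪ M.lowerClosure B) :
    M.dualLowerClosure S = M.dualLowerClosure B := by
  have hBB : M.E \ (M.E \ B) = B := Set.sdiff_sdiff_cancel_left hB.subset_ground
  refine hB.compl_isBase_dual.lowerClosure_eq (S := M.E \ S) Set.sdiff_subset ?_ ?_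
  · rw [dualLowerClosure, dual_dual, dual_ground, hBB]
    rintro e ⟨⟨heE, heB⟩, he⟩
    exact ⟨heE, fun heS => (h₂ heS).elim heB he⟩
  · rintro e ⟨heE, heS⟩
    by_cases heB : e ∈ B
    · exact Or.inr (by_contra fun he => heS (h₁ ⟨heB, he⟩))
    · exact Or.inl ⟨heE, heB⟩

/-- A basis `B` is determined by any set of the interval from `B \ IA(B)` to `B ∪ EA(B)`. -/
theorem IsBase.eq_of_mem_interval {M : Matroid α} {B S : Set α} (hB : M.IsBase B) (hSE : S ⊆ M.E)
    (h₁ : B \ M.dualLowerClosure B ⊆ S) (h₂ : S ⊆ B ∪ M.lowerClosure B) :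
    B = (S \ M.lowerClosure S) ∪ (M.dualLowerClosure S \ S) := by
  rw [hB.lowerClosure_eq hSE h₁ h₂, hB.dualLowerClosure_eq h₁ h₂]
  ext e
  constructor
  · intro he
    by_cases heS : e ∈ S
    · exact Or.inl ⟨heS, hB.indep.notMem_lowerClosure he⟩
    · exact Or.inr ⟨by_contra fun h => heS (h₁ ⟨he, h⟩), heS⟩
  · rintro (⟨heS, he⟩ | ⟨he, heS⟩)
    · exact (h₂ heS).resolve_right he
    · by_contra heB
      exact hB.compl_isBase_dual.indep.notMem_lowerClosure
        ⟨M.dualLowerClosure_subset_ground B he, heB⟩ he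

theorem Indep.isBase_union_dualLowerClosure {M : Matroid α} [M.Finite] {I : Set α}
    (hI : M.Indep I) : M.IsBase (I ∪ M.dualLowerClosure I) := by
  have hsp : M✶.Spanning (M.E \ I) := by
    have := hI.coindep.compl_spanning
    rwa [dual_ground] at this
  have hG := ((M✶.isBasis_sdiff_lowerClosure (S := M.E \ I) Set.sdiff_subset).isBase_of_spanning
    hsp).compl_isBase_dual
  rw [dual_dual, dual_ground] at hG
  convert hG using 1
  ext e
  have h₁ : e ∈ I → e ∈ M.E := fun h => hI.subset_ground h
  have h₂ : e ∈ M.dualLowerClosure I → e ∈ M.E := fun h => M.dualLowerClosure_subset_ground I h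
  change _ ↔ e ∈ M.E ∧ ¬ ((e ∈ M.E ∧ e ∉ I) ∧ e ∉ M.dualLowerClosure I)
  rw [Set.mem_union]
  tauto

theorem dualLowerClosure_union {M : Matroid α} [M.Finite] {I : Set α} :
    M.dualLowerClosure (I ∪ M.dualLowerClosure I) = M.dualLowerClosure I := by
  have h := M✶.lowerClosure_sdiff_lowerClosure (S := M.E \ I) Set.sdiff_subset
  rwa [Set.sdiff_sdiff] at h

/-- The set `(S \ IA(S)) ∪ EA(S)` by whose inclusion unrelated independent sets are compared. -/
def activePart (M : Matroid α) (S : Set α) : Set α :=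
  (S \ M.dualLowerClosure S) ∪ M.lowerClosure S

/-- An independent set lies in the interval of its related basis `I ∪ Y`. -/
theorem union_dualLowerClosure_sdiff_subset {M : Matroid α} [M.Finite] {I : Set α} :
    (I ∪ M.dualLowerClosure I) \ M.dualLowerClosure (I ∪ M.dualLowerClosure I) ⊆ I := by
  rw [dualLowerClosure_union]
  rintro e ⟨he | he, he'⟩
  · exact he
  · exact absurd he he'

theorem Indep.lowerClosure_union {M : Matroid α} [M.Finite] {I : Set α} (hI : M.Indep I) :
    M.lowerClosure (I ∪ M.dualLowerClosure I) = M.lowerClosure I :=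
  (hI.isBase_union_dualLowerClosure.lowerClosure_eq hI.subset_ground
    union_dualLowerClosure_sdiff_subset
    (Set.subset_union_left.trans Set.subset_union_left)).symm

/-- The set `(I \ IA(I)) ∪ EA(I)` lies in the interval of the basis related to `I`, so that it
determines that basis. -/
theorem Indep.union_eq_union_iff {M : Matroid α} [M.Finite] {I J : Set α} (hI : M.Indep I)
    (hJ : M.Indep J) :
    I ∪ M.dualLowerClosure I = J ∪ M.dualLowerClosure J ↔ M.activePart I = M.activePart J := by
  have key : ∀ {I : Set α}, M.Indep I →
      M.activePart I = M.activePart (I ∪ M.dualLowerClosure I) := by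
    intro I hI
    rw [activePart, activePart, hI.lowerClosure_union, dualLowerClosure_union,
      Set.union_sdiff_right]
  have key' : ∀ {B : Set α}, M.IsBase B → B =
      (M.activePart B \ M.lowerClosure (M.activePart B)) ∪
        (M.dualLowerClosure (M.activePart B) \ M.activePart B) := fun {B} hB =>
    hB.eq_of_mem_interval
      (Set.union_subset (Set.sdiff_subset.trans hB.subset_ground) (M.lowerClosure_subset_ground _))
      Set.subset_union_left (Set.union_subset_union_left _ Set.sdiff_subset)
  constructor
  · intro h
    rw [key hI, key hJ, h]
  · intro h
    rw [key hI, key hJ] at h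
    rw [key' hI.isBase_union_dualLowerClosure, h, ← key' hJ.isBase_union_dualLowerClosure]

/-! ### Comparison and exchange of independent sets -/

theorem activePart_subset_of_subset {M : Matroid α} {I J : Set α} (hI : M.Indep I)
    (h : I ⊆ J ∪ M.lowerClosure J) : M.activePart I ⊆ M.activePart J := by
  rintro i (⟨hiI, hi⟩ | hi)
  · rcases h hiI with hiJ | hiJ
    · have hiE := hI.subset_ground hiI
      refine Or.inl ⟨hiJ, ?_⟩
      rw [mem_dualLowerClosure_iff hiE, not_not] at hi ⊢
      rw [← closure_inter_ground] at hi
      refine M.closure_subset_closure_of_subset_closure ?_ hi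
      rintro f ⟨⟨hf, hfi⟩, hfE⟩
      rcases lt_or_gt_of_ne hfi with hlt | hgt
      · rcases h (hf.resolve_right (not_lt_of_gt hlt)) with hfJ | hfJ
        · exact M.mem_closure_of_mem' ⟨Or.inl hfJ, hfi⟩ hfE
        · exact M.closure_subset_closure
            (show J ∩ Set.Iio f ⊆ (J ∪ Set.Ioi i) \ {i} from
            fun _ hg => ⟨Or.inl hg.1, ne_of_lt (lt_trans hg.2 hlt)⟩) hfJ
      · exact M.mem_closure_of_mem' ⟨Or.inr hgt, hfi⟩ hfE
    · exact Or.inr hiJ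
  · exact Or.inr (lowerClosure_subset_of_subset hI.subset_ground h hi)

/-- The completion of `I` to its related basis grows when `I` is replaced by a subset of
`I ∪ EA(I)`. -/
theorem dualLowerClosure_sdiff_subset {M : Matroid α} {I J : Set α} (hI : M.Indep I)
    (h : J ⊆ I ∪ M.lowerClosure I) :
    M.dualLowerClosure I \ I ⊆ M.dualLowerClosure J \ J := by
  rintro y ⟨hy, hyI⟩
  have hyE := M.dualLowerClosure_subset_ground I hy
  have hJ : J ⊆ M.closure I := h.trans
    (Set.union_subset (M.subset_closure I hI.subset_ground) (M.lowerClosure_subset_closure I))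
  have hsub : I ⊆ (I ∪ Set.Ioi y) \ {y} := fun f hf => ⟨Or.inl hf, fun hfy => hyI (hfy ▸ hf)⟩
  rw [mem_dualLowerClosure_iff hyE] at hy
  refine ⟨?_, fun hyJ => hy (M.closure_subset_closure hsub (hJ hyJ))⟩
  rw [mem_dualLowerClosure_iff hyE]
  intro hyJ
  rw [← closure_inter_ground] at hyJ
  refine hy (M.closure_subset_closure_of_subset_closure ?_ hyJ)
  rintro f ⟨⟨hf | hf, hfy⟩, hfE⟩
  · exact M.closure_subset_closure hsub (hJ hf)
  · exact M.mem_closure_of_mem' ⟨Or.inr hf, hfy⟩ hfE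

/-- The exchange step behind the shelling. Deleting `i` from `I` may lose elements from the lower
closure; adding the smallest one that is lost restores all larger ones. -/
theorem Indep.exists_exchange {M : Matroid α} [M.Finite] {I : Set α} (hI : M.Indep I) {i : α}
    (hi : i ∈ I) :
    ∃ J, M.Indep J ∧ I \ {i} ⊆ J ∧ J ⊆ I ∪ M.lowerClosure I ∧ i ∉ J ∧
      M.lowerClosure I ⊆ J ∪ M.lowerClosure J := by
  have hI' : M.Indep (I \ {i}) := hI.subset Set.sdiff_subset
  by_cases hL : M.lowerClosure I ⊆ M.lowerClosure (I \ {i})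
  · exact ⟨I \ {i}, hI', subset_rfl, Set.sdiff_subset.trans Set.subset_union_left,
      fun h => h.2 rfl, hL.trans Set.subset_union_right⟩
  obtain ⟨j, ⟨hjI, hj⟩, hmin⟩ := Set.exists_min_image
    (M.lowerClosure I \ M.lowerClosure (I \ {i})) id
    (M.ground_finite.subset (Set.sdiff_subset.trans (M.lowerClosure_subset_ground I)))
    (Set.not_subset.1 hL)
  have hjE := M.lowerClosure_subset_ground I hjI
  have hins : I ∩ Set.Iio j ⊆ insert i ((I \ {i}) ∩ Set.Iio j) := fun f hf => by
    by_cases hfi : f = i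
    · exact Or.inl hfi
    · exact Or.inr ⟨⟨hf.1, hfi⟩, hf.2⟩
  have hex := M.closure_exchange ⟨M.closure_subset_closure hins hjI, hj⟩
  refine ⟨insert j (I \ {i}), ?_, Set.subset_insert _ _, ?_, ?_, ?_⟩
  · -- Closures of subsets of `I` intersect in the closure of the intersection, so that `j` is
    -- not even spanned by all of `I \ {i}`.
    refine hI'.insert_indep_iff.2 (Or.inl ⟨hjE, fun hj' => hj ?_⟩)
    have hunion : M.Indep ((I \ {i}) ∪ (I ∩ Set.Iio j)) :=
      hI.subset (Set.union_subset Set.sdiff_subset Set.inter_subset_left)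
    have hmem : j ∈ M.closure ((I \ {i}) ∩ (I ∩ Set.Iio j)) := by
      rw [hunion.closure_inter_eq_inter_closure]
      exact ⟨hj', hjI⟩
    exact M.closure_subset_closure
      (show (I \ {i}) ∩ (I ∩ Set.Iio j) ⊆ (I \ {i}) ∩ Set.Iio j from
        fun _ hf => ⟨hf.1, hf.2.2⟩) hmem
  · exact Set.insert_subset (Or.inr hjI) (Set.sdiff_subset.trans Set.subset_union_left)
  · rintro (rfl | h)
    · exact hI.notMem_lowerClosure hi hjI
    · exact h.2 rfl
  · intro e he
    rcases lt_trichotomy e j with hej | rfl | hje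
    · refine Or.inr (M.lowerClosure_mono (Set.subset_insert _ _) ?_)
      exact by_contra fun h => not_le_of_gt hej (hmin e ⟨he, h⟩)
    · exact Or.inl (Set.mem_insert _ _)
    · refine Or.inr (M.closure_subset_closure_of_subset_closure ?_ he)
      rintro f ⟨hfI, hfe⟩
      by_cases hfi : f = i
      · subst hfi
        refine M.closure_subset_closure ?_ hex.1
        rintro g (rfl | hg)
        · exact ⟨Set.mem_insert _ _, hje⟩
        · exact ⟨Set.mem_insert_of_mem _ hg.1, lt_trans hg.2 hje⟩
      · exact M.mem_closure_of_mem' ⟨Set.mem_insert_of_mem _ ⟨hfI, hfi⟩, hfe⟩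
          (hI.subset_ground hfI)

end Matroid

namespace Matroid

variable {α : Type*}

/-! ### Ranks, independent sets and the Tutte polynomial at `y = 1` -/

theorem coe_groundFinset (M : Matroid α) [M.Finite] : (M.groundFinset : Set α) = M.E :=
  M.ground_finite.coe_toFinset

theorem coe_natRank (M : Matroid α) [M.Finite] : (M.natRank : ℕ∞) = M.eRank :=
  ENat.natCast_toNat (M.eRank_ne_top_iff.2 inferInstance)

theorem coe_natRk (M : Matroid α) [M.Finite] (S : Set α) : (M.natRk S : ℕ∞) = M.eRk S :=
  ENat.natCast_toNat (ne_top_of_le_ne_top (M.eRank_ne_top_iff.2 inferInstance) (M.eRk_le_eRank S))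

theorem IsBase.card_eq_natRank {M : Matroid α} [M.Finite] {B : Finset α}
    (hB : M.IsBase (B : Set α)) : B.card = M.natRank := by
  have h := hB.encard_eq_eRank
  rw [Set.encard_coe_eq_coe_finsetCard, ← coe_natRank] at h
  exact_mod_cast h

theorem Indep.card_le_natRank {M : Matroid α} [M.Finite] {I : Finset α}
    (hI : M.Indep (I : Set α)) : I.card ≤ M.natRank := by
  have h := hI.encard_le_eRank
  rw [Set.encard_coe_eq_coe_finsetCard, ← coe_natRank] at h
  exact_mod_cast h

theorem natRk_le_card (M : Matroid α) [M.Finite] (S : Finset α) :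
    M.natRk (S : Set α) ≤ S.card := by
  have h := M.eRk_le_encard (S : Set α)
  rw [Set.encard_coe_eq_coe_finsetCard, ← coe_natRk] at h
  exact_mod_cast h

theorem indep_iff_natRk_eq_card (M : Matroid α) [M.Finite] (S : Finset α) :
    M.Indep (S : Set α) ↔ M.natRk (S : Set α) = S.card := by
  rw [indep_iff_eRk_eq_encard, Set.encard_coe_eq_coe_finsetCard, ← coe_natRk]
  exact_mod_cast Iff.rfl

theorem IndepSet.indep {M : Matroid α} [M.Finite] (I : M.IndepSet) :
    M.Indep ((I : Finset α) : Set α) :=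
  mem_indepFinsets.1 I.2

/-- At `y = 1` only the independent sets contribute to the Tutte polynomial. -/
theorem aeval_tuttePolynomial (M : Matroid α) [M.Finite] :
    MvPolynomial.aeval ![1 + Polynomial.X, (1 : Polynomial ℤ)] M.tuttePolynomial =
      ∑ I ∈ M.indepFinsets, (Polynomial.X : Polynomial ℤ) ^ (M.natRank - I.card) := by
  rw [tuttePolynomial, map_sum, indepFinsets, Finset.sum_filter]
  refine Finset.sum_congr rfl fun S _ => ?_
  have hle := M.natRk_le_card S
  rw [indep_iff_natRk_eq_card]
  split_ifs with h
  · simp [h]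
  · have : S.card - M.natRk (S : Set α) ≠ 0 := by omega
    simp [this]

theorem card_zSet (S : Finset α) : (zSet S).card = S.card :=
  Finset.card_image_of_injective _ fun _ _ h => XYZ.z.inj h

variable [LinearOrder α]

/-! ### Activities and related bases of finsets -/

theorem coe_EA (M : Matroid α) [M.Finite] (S : Finset α) :
    (M.EA S : Set α) = M.lowerClosure S \ S := by
  ext e
  have hiff : e ∈ M.EA S ↔ (e ∈ M.E ∧ e ∉ S) ∧
      ∃ γ : Set α, M.IsCircuit γ ∧ γ ⊆ insert e (S : Set α) ∧ IsGreatest γ e := by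
    rw [EA, Finset.mem_filter, Finset.mem_sdiff, ← Finset.mem_coe (s := M.groundFinset),
      coe_groundFinset]
  rw [Finset.mem_coe, hiff, Set.mem_sdiff, Finset.mem_coe]
  constructor
  · rintro ⟨⟨-, heS⟩, γ, hγ, hγS, hγe⟩
    refine ⟨M.closure_subset_closure ?_ (hγ.mem_closure_sdiff_singleton_of_mem hγe.1), heS⟩
    rintro f ⟨hfγ, hfe⟩
    exact ⟨(hγS hfγ).resolve_left hfe, lt_of_le_of_ne (hγe.2 hfγ) hfe⟩
  · rintro ⟨he, heS⟩
    obtain ⟨γ, hγS, hγ, heγ⟩ := exists_isCircuit_of_mem_closure he fun h => heS h.1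
    refine ⟨⟨M.lowerClosure_subset_ground _ he, heS⟩, γ, hγ,
      hγS.trans (Set.insert_subset_insert Set.inter_subset_left), heγ, fun f hf => ?_⟩
    rcases hγS hf with rfl | hf
    · exact le_rfl
    · exact le_of_lt hf.2

theorem coe_IA (M : Matroid α) [M.Finite] (S : Finset α) :
    (M.IA S : Set α) = ↑S ∩ M.dualLowerClosure S := by
  ext i
  rw [Finset.mem_coe, IA, Finset.mem_filter, ← Finset.mem_coe (s := M✶.EA _), coe_EA,
    Finset.coe_sdiff, coe_groundFinset]
  exact ⟨fun h => ⟨h.1, h.2.1⟩, fun h => ⟨h.1, h.2, fun h' => h'.2 h.1⟩⟩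

theorem coe_EA_of_indep {M : Matroid α} [M.Finite] {I : Finset α} (hI : M.Indep (I : Set α)) :
    (M.EA I : Set α) = M.lowerClosure I := by
  rw [coe_EA]
  exact sdiff_eq_left.2 (Set.disjoint_right.2 fun _ he => hI.notMem_lowerClosure he)

theorem coe_union_EA (M : Matroid α) [M.Finite] (I : Finset α) :
    ((I ∪ M.EA I : Finset α) : Set α) = ↑I ∪ M.lowerClosure I := by
  rw [Finset.coe_union, coe_EA, Set.union_sdiff_self]

/-- **Crapo's theorem** for an independent set `I`, with an explicit description of the related
basis. -/
theorem isRelatedBasis_iff {M : Matroid α} [M.Finite] {I B : Finset α} :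
    M.IsRelatedBasis I B ↔
      M.Indep (I : Set α) ∧ (B : Set α) = ↑I ∪ M.dualLowerClosure I := by
  constructor
  · rintro ⟨hB, Y, hY, rfl⟩
    have hY' : (Y : Set α) ⊆ M.dualLowerClosure B := by
      have := Finset.coe_subset.2 hY
      rw [coe_IA] at this
      exact this.trans Set.inter_subset_right
    have hI : M.Indep ((B \ Y : Finset α) : Set α) :=
      hB.indep.subset (Finset.coe_subset.2 Finset.sdiff_subset)
    have h := hB.eq_of_mem_interval hI.subset_ground
      (by rw [Finset.coe_sdiff]; exact Set.sdiff_subset_sdiff_right hY')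
      (Set.subset_union_of_subset_left (Finset.coe_subset.2 Finset.sdiff_subset) _)
    rw [sdiff_eq_left.2 (Set.disjoint_left.2 fun _ he => hI.notMem_lowerClosure he),
      Set.union_sdiff_self] at h
    exact ⟨hI, h⟩
  · rintro ⟨hI, hB⟩
    have hIB : I ⊆ B := Finset.coe_subset.1 (hB ▸ Set.subset_union_left)
    refine ⟨hB ▸ hI.isBase_union_dualLowerClosure, B \ I, ?_,
      (Finset.sdiff_sdiff_eq_self hIB).symm⟩
    rw [← Finset.coe_subset, coe_IA, Finset.coe_sdiff, hB, dualLowerClosure_union]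
    rintro e ⟨he, heI⟩
    exact ⟨he, he.resolve_left heI⟩

theorem isRelatedBasis_relatedBasis {M : Matroid α} [M.Finite] {I : Finset α}
    (hI : M.Indep (I : Set α)) : M.IsRelatedBasis I (M.relatedBasis I) := by
  have hB := hI.isBase_union_dualLowerClosure
  obtain ⟨B, hBI⟩ := (M.ground_finite.subset hB.subset_ground).exists_finset_coe
  have hex : ∃ B, M.IsRelatedBasis I B := ⟨B, isRelatedBasis_iff.2 ⟨hI, hBI⟩⟩
  rw [relatedBasis, dif_pos hex]
  exact hex.choose_spec

theorem coe_relatedBasis {M : Matroid α} [M.Finite] {I : Finset α}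
    (hI : M.Indep (I : Set α)) :
    (M.relatedBasis I : Set α) = ↑I ∪ M.dualLowerClosure I :=
  (isRelatedBasis_iff.1 (isRelatedBasis_relatedBasis hI)).2

theorem internallyRelated_iff {M : Matroid α} [M.Finite] {I J : Finset α}
    (hI : M.Indep (I : Set α)) (hJ : M.Indep (J : Set α)) :
    M.InternallyRelated I J ↔ M.activePart I = M.activePart J := by
  rw [← hI.union_eq_union_iff hJ]
  constructor
  · rintro ⟨B, hIB, hJB⟩
    rw [← (isRelatedBasis_iff.1 hIB).2, ← (isRelatedBasis_iff.1 hJB).2]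
  · intro h
    exact ⟨M.relatedBasis I, isRelatedBasis_relatedBasis hI,
      isRelatedBasis_iff.2 ⟨hJ, (coe_relatedBasis hI).trans h⟩⟩

/-! ### The external/internal order -/

/-- Distinct related bases have distinct active parts, so the external/internal order is the
lexicographic combination of the inclusion of active parts with the inclusion of sets. -/
theorem extIntLE_iff {M : Matroid α} [M.Finite] {I J : M.IndepSet} :
    M.ExtIntLE I J ↔
      M.activePart (I : Finset α) ⊂ M.activePart (J : Finset α) ∨
        (M.activePart (I : Finset α) = M.activePart (J : Finset α) ∧
          (I : Finset α) ⊆ (J : Finset α)) := by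
  have hpart : ∀ K : M.IndepSet,
      ((((K : Finset α) \ M.IA K) ∪ M.EA K : Finset α) : Set α) =
        M.activePart (K : Finset α) := fun K => by
    rw [Finset.coe_union, Finset.coe_sdiff, coe_IA, coe_EA_of_indep K.indep,
      Set.sdiff_self_inter, activePart]
  rw [ExtIntLE, internallyRelated_iff I.indep J.indep, ← Finset.coe_subset (s₁ := _ ∪ _), hpart,
    hpart, ssubset_iff_subset_ne, and_comm (a := ¬ _)]

theorem isPartialOrder_extIntLE (M : Matroid α) [M.Finite] :
    IsPartialOrder M.IndepSet M.ExtIntLE where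
  refl I := extIntLE_iff.2 (Or.inr ⟨rfl, subset_rfl⟩)
  trans I J K hIJ hJK := by
    rw [extIntLE_iff] at *
    rcases hIJ with hIJ | ⟨hIJ, hIJ'⟩
    · rcases hJK with hJK | ⟨hJK, -⟩
      · exact Or.inl (hIJ.trans hJK)
      · exact Or.inl (hJK ▸ hIJ)
    · rw [hIJ]
      exact hJK.imp_right fun h => ⟨h.1, hIJ'.trans h.2⟩
  antisymm I J hIJ hJI := by
    rw [extIntLE_iff] at *
    rcases hIJ with hIJ | ⟨hIJ, hIJ'⟩
    · rcases hJI with hJI | ⟨hJI, -⟩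
      · exact absurd (hIJ.trans hJI) (ssubset_irrefl _)
      · exact absurd hJI.symm hIJ.ne
    · rcases hJI with hJI | ⟨-, hJI⟩
      · exact absurd hIJ.symm hJI.ne
      · exact Subtype.ext (subset_antisymm hIJ' hJI)

/-- The inclusion `I ⊆ J ∪ EA(J)` says that the facet of `J` contains `z_I`, so this orders all
facets containing `z_I` after that of `I`. -/
theorem extIntLE_of_subset {M : Matroid α} [M.Finite] {I J : M.IndepSet}
    (h : (I : Finset α) ⊆ (J : Finset α) ∪ M.EA J) : M.ExtIntLE I J := by
  have h' : ((I : Finset α) : Set α) ⊆ ↑(J : Finset α) ∪ M.lowerClosure (J : Finset α) := by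
    rw [← coe_union_EA]
    exact Finset.coe_subset.2 h
  have hsub := activePart_subset_of_subset I.indep h'
  rw [extIntLE_iff]
  rcases hsub.ssubset_or_eq with hlt | heq
  · exact Or.inl hlt
  · refine Or.inr ⟨heq, fun e he => (h' he).resolve_right fun heJ => ?_⟩
    -- Internally related sets have the same externally active elements.
    have hunion := (I.indep.union_eq_union_iff J.indep).2 heq
    rw [← J.indep.lowerClosure_union, ← hunion, I.indep.lowerClosure_union] at heJ
    exact I.indep.notMem_lowerClosure he heJ

/-! ### Facets of the augmented external activity complex -/

section Facets

variable {M : Matroid α} [M.Finite] {I : Finset α}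

theorem union_EP (I : Finset α) (hI : M.Indep (I : Set α)) :
    I ∪ M.EP I = M.groundFinset \ M.EA I := by
  have hIE : I ⊆ M.groundFinset := by
    rw [← Finset.coe_subset, coe_groundFinset]
    exact hI.subset_ground
  ext e
  have h₁ := @hIE e
  have h₂ : e ∈ M.EA I → e ∉ I := fun h =>
    (Finset.mem_sdiff.1 (Finset.mem_filter.1 h).1).2
  simp only [EP, Finset.mem_union, Finset.mem_sdiff]
  tauto

theorem disjoint_EA (M : Matroid α) [M.Finite] (I : Finset α) : Disjoint I (M.EA I) :=
  Finset.disjoint_right.2 fun _ h => (Finset.mem_sdiff.1 (Finset.mem_filter.1 h).1).2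

theorem zSet_subset_augFacet_iff {J : Finset α} :
    zSet J ⊆ M.augFacet I ↔ J ⊆ I ∪ M.EA I := by
  constructor
  · intro h e he
    have := h (Finset.mem_image_of_mem XYZ.z he)
    simpa [augFacet, xSet, ySet, zSet] using this
  · intro h
    exact (Finset.image_subset_image h).trans Finset.subset_union_right

theorem card_augFacet (hI : M.Indep (I : Set α)) :
    (M.augFacet I).card = M.groundFinset.card + M.natRank := by
  have hx : Function.Injective (XYZ.x (α := α)) := fun _ _ h => XYZ.x.inj h
  have hy : Function.Injective (XYZ.y (α := α)) := fun _ _ h => XYZ.y.inj h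
  have hz : Function.Injective (XYZ.z (α := α)) := fun _ _ h => XYZ.z.inj h
  have hB := isRelatedBasis_relatedBasis hI
  have hIB : I ⊆ M.relatedBasis I := by
    rw [← Finset.coe_subset, coe_relatedBasis hI]
    exact Set.subset_union_left
  have hEA : M.EA I ⊆ M.groundFinset :=
    (Finset.filter_subset _ _).trans Finset.sdiff_subset
  rw [augFacet, Finset.card_union_of_disjoint, Finset.card_union_of_disjoint, xSet, ySet, zSet,
    Finset.card_image_of_injective _ hx, Finset.card_image_of_injective _ hy,
    Finset.card_image_of_injective _ hz, union_EP I hI, Finset.card_sdiff_of_subset hEA,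
    Finset.card_sdiff_of_subset hIB, Finset.card_union_of_disjoint (M.disjoint_EA I),
    ← hB.1.card_eq_natRank]
  · have := Finset.card_le_card hEA
    have := Finset.card_le_card hIB
    omega
  · simp [Finset.disjoint_left, xSet, ySet]
  · simp only [Finset.disjoint_left, xSet, ySet, zSet, Finset.mem_union, Finset.mem_image]
    rintro _ (⟨_, _, rfl⟩ | ⟨_, _, rfl⟩) ⟨_, _, h⟩ <;> cases h

/-- Every set obtained from the facet of `I` by deleting some `z_i`, `i ∈ I`, lies in the facet of
another independent set `J ⊆ I ∪ EA(I)`; such a `J` comes before `I`. -/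
theorem exists_augFacet_sdiff_subset (hI : M.Indep (I : Set α)) {i : α} (hi : i ∈ I) :
    ∃ J : Finset α, M.Indep (J : Set α) ∧ J ⊆ I ∪ M.EA I ∧ i ∉ J ∧
      M.augFacet I \ {XYZ.z i} ⊆ M.augFacet J := by
  obtain ⟨J', hJ, hIJ, hJI, hiJ, hL⟩ := hI.exists_exchange (Finset.mem_coe.2 hi)
  obtain ⟨J, rfl⟩ := (M.ground_finite.subset hJ.subset_ground).exists_finset_coe
  refine ⟨J, hJ, ?_, fun h => hiJ (Finset.mem_coe.2 h), ?_⟩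
  · rw [← Finset.coe_subset, coe_union_EA]
    exact hJI
  have hEA : M.EA J ⊆ M.EA I := by
    rw [← Finset.coe_subset, coe_EA_of_indep hI, coe_EA_of_indep hJ]
    exact lowerClosure_subset_of_subset hJ.subset_ground hJI
  have hY : M.relatedBasis I \ I ⊆ M.relatedBasis J \ J := by
    rw [← Finset.coe_subset, Finset.coe_sdiff, Finset.coe_sdiff, coe_relatedBasis hI,
      coe_relatedBasis hJ, Set.union_sdiff_left, Set.union_sdiff_left]
    exact dualLowerClosure_sdiff_subset hI hJI
  have hZ : (I ∪ M.EA I) \ {i} ⊆ J ∪ M.EA J := by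
    rw [← Finset.coe_subset, Finset.coe_sdiff, coe_union_EA, coe_union_EA, Finset.coe_singleton,
      Set.union_sdiff_distrib]
    exact Set.union_subset (hIJ.trans Set.subset_union_left) (Set.sdiff_subset.trans hL)
  intro v hv
  rw [augFacet, union_EP I hI, Finset.mem_sdiff, Finset.mem_union, Finset.mem_union,
    Finset.mem_singleton] at hv
  rw [augFacet, union_EP J hJ, Finset.mem_union, Finset.mem_union]
  rcases hv with ⟨(hv | hv) | hv, hvi⟩
  · exact Or.inl (Or.inl (Finset.image_subset_image (Finset.sdiff_subset_sdiff subset_rfl hEA) hv))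
  · exact Or.inl (Or.inr (Finset.image_subset_image hY hv))
  · obtain ⟨e, he, rfl⟩ := Finset.mem_image.1 hv
    refine Or.inr (Finset.mem_image_of_mem _ (hZ (Finset.mem_sdiff.2 ⟨he, fun hei => hvi ?_⟩)))
    rw [Finset.mem_singleton.1 hei]

end Facets

theorem isShellingData_augComplex {M : Matroid α} [M.Finite] {L : LinearOrder M.IndepSet}
    (hL : M.IsLinearExtension L) :
    M.augComplex.IsShellingData L (fun I : M.IndepSet => M.augFacet I)
      (fun I : M.IndepSet => zSet (I : Finset α)) (M.groundFinset.card + M.natRank) where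
  mem_faces G := by
    simp [augComplex, FaceComplex.generatedBy]
  card_eq I := card_augFacet I.indep
  subset I := zSet_subset_augFacet_iff.2 Finset.subset_union_left
  le_of_subset I J h := hL I J (extIntLE_of_subset (zSet_subset_augFacet_iff.1 h))
  exists_lt I v hv := by
    obtain ⟨i, hi, rfl⟩ := Finset.mem_image.1 hv
    obtain ⟨J, hJ, hJI, hiJ, hsub⟩ := exists_augFacet_sdiff_subset I.indep hi
    refine ⟨⟨J, mem_indepFinsets.2 hJ⟩, ?_, hsub⟩
    refine @lt_of_le_of_ne _ L.toPartialOrder _ _ (hL _ _ (extIntLE_of_subset hJI)) ?_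
    rintro rfl
    exact hiJ hi

/-! ### The `h`-vector -/

theorem exists_isLinearExtension (M : Matroid α) [M.Finite] :
    ∃ L : LinearOrder M.IndepSet, M.IsLinearExtension L := by
  have := M.isPartialOrder_extIntLE
  obtain ⟨s, hs, hle⟩ := extend_partialOrder M.ExtIntLE
  exact ⟨{ le := s
           lt := fun I J => s I J ∧ ¬ s J I
           lt_iff_le_not_ge := fun _ _ => Iff.rfl
           le_refl := hs.refl
           le_trans := hs.trans
           le_antisymm := hs.antisymm
           le_total := hs.total
           toDecidableLE := Classical.decRel _ }, fun I J h => hle I J h⟩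

theorem hPolynomial_augComplex (M : Matroid α) [M.Finite] :
    M.augComplex.hPolynomial =
      ∑ I ∈ M.indepFinsets,
        (Polynomial.X : Polynomial ℤ) ^ (M.groundFinset.card + M.natRank - I.card) := by
  obtain ⟨L, hL⟩ := M.exists_isLinearExtension
  rw [(isShellingData_augComplex hL).hPolynomial_eq]
  simp only [card_zSet]
  exact Finset.sum_coe_sort M.indepFinsets
    fun I => (Polynomial.X : Polynomial ℤ) ^ (M.groundFinset.card + M.natRank - I.card)

theorem hVector_augComplex (M : Matroid α) [M.Finite] (i : ℕ) :
    M.augComplex.hVector i = (M.independenceComplex.fVector i : ℤ) := by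
  obtain ⟨L, hL⟩ := M.exists_isLinearExtension
  have hcard : ∀ I ∈ M.indepFinsets, I.card ≤ M.groundFinset.card + M.natRank := fun I hI =>
    (mem_indepFinsets.1 hI).card_le_natRank.trans (Nat.le_add_left _ _)
  rw [FaceComplex.hVector, (isShellingData_augComplex hL).maxCard_eq, hPolynomial_augComplex,
    FaceComplex.fVector, independenceComplex]
  split_ifs with hi
  · rw [Polynomial.finsetSum_coeff, Finset.card_filter, Nat.cast_sum]
    refine Finset.sum_congr rfl fun I hI => ?_
    have := hcard I hI
    rw [Polynomial.coeff_X_pow, Nat.cast_ite, Nat.cast_one, Nat.cast_zero]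
    exact if_congr (by omega) rfl rfl
  · rw [Finset.card_eq_zero.2 (Finset.filter_eq_empty_iff.2 fun I hI (h : I.card = i) =>
      hi (h ▸ hcard I hI)),
      Nat.cast_zero]

end Matroid
end
theorem mainTheorem2 {α : Type*} [LinearOrder α] (M : Matroid α) [M.Finite] :
    IsPartialOrder M.IndepSet M.ExtIntLE ∧
    (∀ L : LinearOrder M.IndepSet, M.IsLinearExtension L →
      M.augComplex.IsShellingOrder L (fun I : M.IndepSet => M.augFacet I) ∧
      ∀ I : M.IndepSet,
        IsRestrictionSet L (fun J : M.IndepSet => M.augFacet J) I (zSet (I : Finset α))) ∧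
    (∀ i : ℕ, M.augComplex.hVector i = (M.independenceComplex.fVector i : ℤ)) ∧
    M.augComplex.hPolynomial =
      ∑ I ∈ M.indepFinsets,
        (Polynomial.X : Polynomial ℤ) ^ (M.groundFinset.card + M.natRank - I.card) ∧
    M.augComplex.hPolynomial =
      Polynomial.X ^ M.groundFinset.card *
        MvPolynomial.aeval ![1 + Polynomial.X, (1 : Polynomial ℤ)] M.tuttePolynomial := by
  refine ⟨M.isPartialOrder_extIntLE, fun L hL => ?_, M.hVector_augComplex,
    M.hPolynomial_augComplex, ?_⟩
  · have h := Matroid.isShellingData_augComplex hL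
    exact ⟨h.isShellingOrder, h.isRestrictionSet⟩
  · rw [M.hPolynomial_augComplex, M.aeval_tuttePolynomial, Finset.mul_sum]
    refine Finset.sum_congr rfl fun I hI => ?_
    rw [← pow_add, Nat.add_sub_assoc (Matroid.mem_indepFinsets.1 hI).card_le_natRank]
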